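/- Let $C$ be a bivariate copula, that is, the joint distribution function of a probability law on $[0,1]^2$ with uniform margins, and let $(U_{11},U_{21}),(U_{12},U_{22}),\dots$ be iid random vectors with distribution function $C$. For $0<u\le 1/2$ put $$\alpha(u)=\log\frac{\mathbb P(U_{11}>1-u,\;U_{21}>1-u)}{\mathbb P(U_{11}\le u,\;U_{21}\le u)},$$ and, based on the first $n$ observations, $$T_L(u)=\frac1n\sum_{i=1}^n\mathbf 1(U_{1i}\le u,\,U_{2i}\le u),\qquad T_U(u)=\frac1n\sum_{i=1}^n\mathbf 1(U_{1i}\ge 1-u,\,U_{2i}\ge 1-u),\qquad \hat\alpha(u)=\log\frac{T_U(u)}{T_L(u)},$$ with the conventions $\log(x/y)=-\infty$ if $x=0<y$, $\log(x/y)=\infty$ if $x>0=y$, and $\log(x/y)=0$ if $x=y=0$. Fix $0<u_1<\dots<u_m\le 1/2$. Let $\boldsymbol a=\sqrt n\,\bigl(\hat\alpha(u_1)-\alpha(u_1),\dots,\hat\alpha(u_m)-\alpha(u_m)\bigr)^T$ and let $\hat{\boldsymbol\Sigma}$ be the symmetric $m\times m$ matrix with entries $$\hat\sigma(u_i,u_j)=\frac{T_L(u_j)+T_U(u_j)}{T_L(u_j)\,T_U(u_j)}\qquad(i\le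 j).$$ Assume that, with probability tending to $1$ as $n\to\infty$, the matrix $\hat{\boldsymbol\Sigma}$ is well defined (i.e. $T_L(u_i)T_U(u_i)\neq0$ for all $i$) and invertible. Then $$\boldsymbol a^T\hat{\boldsymbol\Sigma}^{-1}\boldsymbol a\xrightarrow{\;d\;}\chi^2(m)\qquad(n\to\infty),$$ where $\chi^2(m)$ is the chi-squared distribution with $m$ degrees of freedom. (Whenever a component $\hat\alpha(u_i)$ or $\alpha(u_i)$ is infinite it is replaced by $0$ in $\boldsymbol a$, entries of $\hat{\boldsymbol\Sigma}$ with vanishing denominator are set to $0$, and $\hat{\boldsymbol\Sigma}^{-1}$ is set to $0$ if $\hat{\boldsymbol\Sigma}$ is singular; under the assumption this concerns only events whose probability tends to $0$ and does not affect the limit.) -/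

import Mathlib

open MeasureTheory ProbabilityTheory Filter Topology
open scoped Matrix

noncomputable section

namespace TailAsymmetry

/-- A bivariate copula, given as the probability law on `ℝ × ℝ` whose joint distribution function
it is: both margins are the uniform distribution on `[0, 1]`. -/
structure IsCopulaLaw (ν : Measure (ℝ × ℝ)) : Prop where
  isProbabilityMeasure : IsProbabilityMeasure ν
  map_fst : ν.map Prod.fst = volume.restrict (Set.Icc (0 : ℝ) 1)
  map_snd : ν.map Prod.snd = volume.restrict (Set.Icc (0 : ℝ) 1)

/-- The extended logarithm `log (x / y)` of a ratio of nonnegative reals: `-∞` if `x = 0 < y`,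
`∞` if `x > 0 = y`, and `0` if `x = y = 0`. -/
def logRatio (x y : ℝ) : EReal :=
  if y = 0 then (if x = 0 then 0 else ⊤)
  else if x = 0 then ⊥ else ((Real.log (x / y) : ℝ) : EReal)

/-- The measure of tail asymmetry `α(u)` of a random vector `(X₁, X₂)` with law `ν` and margins
`F₁`, `F₂`:
`α(u) = log (P(F₁(X₁) > 1 - u, F₂(X₂) > 1 - u) / P(F₁(X₁) ≤ u, F₂(X₂) ≤ u))`. -/
def alpha (ν : Measure (ℝ × ℝ)) (u : ℝ) : EReal :=
  logRatio
    (ν.real {x | 1 - u < cdf (ν.map Prod.fst) x.1 ∧ 1 - u < cdf (ν.map Prod.snd) x.2})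
    (ν.real {x | cdf (ν.map Prod.fst) x.1 ≤ u ∧ cdf (ν.map Prod.snd) x.2 ≤ u})

variable {Ω : Type*}

open Classical in
/-- `T_L(u)`, the proportion of the first `n` observations in the lower tail. -/
def TL (U : ℕ → Ω → ℝ × ℝ) (n : ℕ) (u : ℝ) (ω : Ω) : ℝ :=
  (1 / (n : ℝ)) * ∑ i ∈ Finset.range n, if (U i ω).1 ≤ u ∧ (U i ω).2 ≤ u then (1 : ℝ) else 0

open Classical in
/-- `T_U(u)`, the proportion of the first `n` observations in the upper tail. -/
def TU (U : ℕ → Ω → ℝ × ℝ) (n : ℕ) (u : ℝ) (ω : Ω) : ℝ :=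
  (1 / (n : ℝ)) *
    ∑ i ∈ Finset.range n, if 1 - u ≤ (U i ω).1 ∧ 1 - u ≤ (U i ω).2 then (1 : ℝ) else 0

/-- The sample analogue `log (T_U(u) / T_L(u))` of `α(u)`. -/
def alphaHat (U : ℕ → Ω → ℝ × ℝ) (n : ℕ) (u : ℝ) (ω : Ω) : EReal :=
  logRatio (TU U n u ω) (TL U n u ω)

/-- The vector `a = √n (α̂(u_i) - α(u_i))_i`. The conversion `EReal.toReal` is the identity on
finite values, and on infinite values (where `a` is not a real vector) it returns `0`. -/
def aVec (ν : Measure (ℝ × ℝ)) (U : ℕ → Ω → ℝ × ℝ) {m : ℕ} (u : Fin m → ℝ) (n : ℕ) (ω : Ω) :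
    Fin m → ℝ :=
  fun i => Real.sqrt n * ((alphaHat U n (u i) ω).toReal - (alpha ν (u i)).toReal)

/-- The plug-in covariance matrix: for `i ≤ j` its `(i, j)` and `(j, i)` entries are
`(T_L(u_j) + T_U(u_j)) / (T_L(u_j) T_U(u_j))`. -/
def SigmaHat (U : ℕ → Ω → ℝ × ℝ) {m : ℕ} (u : Fin m → ℝ) (n : ℕ) (ω : Ω) :
    Matrix (Fin m) (Fin m) ℝ :=
  Matrix.of fun i j =>
    (TL U n (u (max i j)) ω + TU U n (u (max i j)) ω) /
      (TL U n (u (max i j)) ω * TU U n (u (max i j)) ω)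

/-- The event that the plug-in covariance matrix is well defined (no denominator vanishes)
and invertible. -/
def invertibleEvent (U : ℕ → Ω → ℝ × ℝ) {m : ℕ} (u : Fin m → ℝ) (n : ℕ) : Set Ω :=
  {ω | (∀ i, TL U n (u i) ω * TU U n (u i) ω ≠ 0) ∧ IsUnit (SigmaHat U u n ω)}

/-- The test statistic `aᵀ Σ̂⁻¹ a`. -/
def testStatistic (ν : Measure (ℝ × ℝ)) (U : ℕ → Ω → ℝ × ℝ) {m : ℕ} (u : Fin m → ℝ) (n : ℕ)
    (ω : Ω) : ℝ :=
  aVec ν U u n ω ⬝ᵥ ((SigmaHat U u n ω)⁻¹ *ᵥ aVec ν U u n ω)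

/-- The chi-squared distribution with `m` degrees of freedom: the law of the sum of the squares of
`m` independent standard normal random variables. -/
def chiSquared (m : ℕ) : Measure ℝ :=
  (Measure.pi fun _ : Fin m => gaussianReal 0 1).map fun z => ∑ i, z i ^ 2

instance (m : ℕ) : IsProbabilityMeasure (chiSquared m) :=
  Measure.isProbabilityMeasure_map
    (Finset.univ.measurable_fun_sum fun i _ => (measurable_pi_apply i).pow_const 2).aemeasurable

end TailAsymmetry

end

/-!
The statistic is asymptotically chi-squared by the delta method together with Slutsky's theorem. Write
`p i` and `q i` for the probabilities of the lower and the upper tail region at the level `u i`.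

The vector `v` of the `2 m` empirical tail frequencies, centred and multiplied by `√n`, converges in
distribution to a (possibly degenerate) Gaussian vector (`tendstoInDistribution_empFreq`, from the
multivariate central limit theorem). The difference quotient of `log` turns the delta method into an
exact identity: as soon as all empirical tail frequencies are positive, the statistic equals a
quadratic form in `v` whose coefficients are difference quotients of `log` and the entries of the
inverse of the plug-in matrix (`testStatistic_eq_pairedForm`). By the strong law of large numbers these
coefficients converge almost surely to `1 / q i`, `1 / p i` and the entries of `Σ⁻¹`, where `Σ` has the
entries `1 / p k + 1 / q k` with `k = max i j` (`tendsto_coeffs`). So the statistic converges in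
distribution to `(L V)ᵀ Σ⁻¹ (L V)`, where `V` is the Gaussian limit of `v` and `L` the derivative of
`log q - log p`.

Since tails are nested and lower and upper tails are almost disjoint, `L V` has covariance matrix `Σ`
(`logRatioDeriv_mul_cov_mul_transpose`), and the quadratic form of a Gaussian vector given by the
inverse of its covariance matrix is chi-squared (`map_quadraticForm_multivariateGaussian`).

What remains is that `p i` and `q i` are positive and that `Σ` is invertible, which has to be read
off from the plug-in matrix. If `p i = 0` or `q i = 0`, the corresponding empirical frequency is
almost surely zero (`tail_prob_ne_zero`). The matrix with entries `s (max i j)` is invertible if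
`s` has no zeros and no repetition at neighbouring indices (`isUnit_of_max`). If `1 / p + 1 / q`
takes the same value at two neighbouring levels, then by monotonicity so do `p` and `q`; almost
surely no observation separates the two levels, and the plug-in matrix is singular for all sample
sizes (`isUnit_limit`).
-/

namespace TailAsymmetry

/-! ### The multivariate central limit theorem -/

section CentralLimit

open scoped RealInnerProductSpace

variable {Ω ι : Type*} [MeasurableSpace Ω] {P : Measure Ω} [IsProbabilityMeasure P]
  [Fintype ι]

/-- The covariance matrix of a random vector with real coordinates. -/
noncomputable def covMatrix (P : Measure Ω) (X : Ω → ι → ℝ) : Matrix ι ι ℝ :=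
  Matrix.of fun i j => cov[fun ω => X ω i, fun ω => X ω j; P]

theorem dotProduct_covMatrix_mulVec {X : Ω → ι → ℝ} (hX : ∀ i, MemLp (fun ω => X ω i) 2 P)
    (t : ι → ℝ) :
    t ⬝ᵥ (covMatrix P X *ᵥ t) = Var[fun ω => ∑ i, t i * X ω i; P] := by
  rw [variance_fun_sum fun i => (hX i).const_mul (t i)]
  simp only [dotProduct, Matrix.mulVec, covMatrix, Matrix.of_apply, Finset.mul_sum,
    covariance_const_mul_left, covariance_const_mul_right]
  exact Finset.sum_congr rfl fun i _ => Finset.sum_congr rfl fun j _ => by ring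

theorem posSemidef_covMatrix {X : Ω → ι → ℝ} (hX : ∀ i, MemLp (fun ω => X ω i) 2 P) :
    (covMatrix P X).PosSemidef := by
  refine .of_dotProduct_mulVec_nonneg ?_ fun t => ?_
  · ext i j
    simp [covMatrix, covariance_comm]
  · rw [star_trivial, dotProduct_covMatrix_mulVec hX]
    exact variance_nonneg _ _

/-- The multivariate central limit theorem. By Lévy's theorem it is enough to know the limit of
the characteristic functions, and the one at `t` is that of the linear combination `∑ i, t i * X i`
at `1`, to which the central limit theorem in dimension one applies. -/
theorem tendstoInDistribution_inv_sqrt_mul_sum_sub_multivariate [DecidableEq ι]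
    {X : ℕ → Ω → ι → ℝ} (hX : ∀ i, MemLp (fun ω => X 0 ω i) 2 P) (hindep : iIndepFun X P)
    (hident : ∀ k, IdentDistrib (X k) (X 0) P P) :
    TendstoInDistribution
      (fun (n : ℕ) ω => (WithLp.toLp 2 fun i =>
        (√n)⁻¹ * (∑ k ∈ Finset.range n, X k ω i - n * ∫ ω', X 0 ω' i ∂P) : EuclideanSpace ℝ ι))
      atTop id (fun _ => P) (multivariateGaussian 0 (covMatrix P (X 0))) := by
  have hXm (k : ℕ) (i : ι) : AEMeasurable (fun ω => X k ω i) P :=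
    (measurable_pi_apply i).comp_aemeasurable (hident k).aemeasurable_fst
  have hm (n : ℕ) : AEMeasurable (fun ω => (WithLp.toLp 2 fun i =>
      (√n)⁻¹ * (∑ k ∈ Finset.range n, X k ω i - n * ∫ ω', X 0 ω' i ∂P) :
        EuclideanSpace ℝ ι)) P := by
    refine (WithLp.measurable_toLp 2 (ι → ℝ)).comp_aemeasurable (aemeasurable_pi_lambda _ fun i => ?_)
    exact ((Finset.aemeasurable_fun_sum _ fun k _ => hXm k i).sub_const _).const_mul _
  refine ⟨hm, aemeasurable_id, ProbabilityMeasure.tendsto_of_tendsto_charFun fun t => ?_⟩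
  have hlin : Measurable fun x : ι → ℝ => ∑ i, t i * x i := by fun_prop
  have hclt := tendstoInDistribution_inv_sqrt_mul_sum_sub
    (X := fun k ω => ∑ i, t i * X k ω i) (Y := id)
    (P' := gaussianReal 0 Var[fun ω => ∑ i, t i * X 0 ω i; P].toNNReal) (P := P) HasLaw.id
    (memLp_finsetSum _ fun i _ => (hX i).const_mul (t i))
    (hindep.comp (fun _ x => ∑ i, t i * x i) fun _ => hlin)
    fun k => (hident k).comp hlin
  have hlim := ProbabilityMeasure.tendsto_iff_tendsto_charFun.1 hclt.tendsto 1
  have hmean : ∫ ω, ∑ i, t i * X 0 ω i ∂P = ∑ i, t i * ∫ ω, X 0 ω i ∂P := by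
    rw [integral_finsetSum _ fun i _ => ((hX i).integrable one_le_two).const_mul (t i)]
    simp [integral_const_mul]
  have hproj (n : ℕ) (ω : Ω) :
      (√n)⁻¹ * (∑ k ∈ Finset.range n, ∑ i, t i * X k ω i - n * ∫ ω', ∑ i, t i * X 0 ω' i ∂P) =
      ⟪(WithLp.toLp 2 fun i => (√n)⁻¹ *
        (∑ k ∈ Finset.range n, X k ω i - n * ∫ ω', X 0 ω' i ∂P) : EuclideanSpace ℝ ι), t⟫ := by
    rw [hmean, Finset.sum_comm]
    simp only [PiLp.inner_apply, RCLike.inner_apply, conj_trivial, Finset.mul_sum,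
      ← Finset.sum_sub_distrib]
    refine Finset.sum_congr rfl fun i _ => ?_
    rw [← Finset.mul_sum]
    ring
  convert! hlim using 2
  · rename_i n
    simp only [ProbabilityMeasure.coe_mk, charFun_apply]
    rw [integral_map (hm n) (by fun_prop),
      integral_map (hclt.forall_aemeasurable n) (by fun_prop)]
    simp [hproj]
  · simp only [ProbabilityMeasure.coe_mk, Measure.map_id]
    rw [charFun_multivariateGaussian (posSemidef_covMatrix hX), charFun_gaussianReal,
      dotProduct_covMatrix_mulVec hX, Real.coe_toNNReal _ (variance_nonneg _ _)]
    simp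

end CentralLimit

/-! ### Quadratic forms in Gaussian vectors -/

/-- The square of the norm of a standard Gaussian vector has the chi-squared distribution. -/
theorem map_sum_sq_stdGaussian (m : ℕ) :
    (stdGaussian (EuclideanSpace ℝ (Fin m))).map (fun x => ∑ i, x i ^ 2) = chiSquared m := by
  rw [← map_pi_eq_stdGaussian, Measure.map_map (by fun_prop) (by fun_prop)]
  rfl

/-- If `V` is Gaussian with mean `0` and covariance matrix `S`, and `L V` has a nondegenerate
covariance matrix `L * S * Lᵀ`, then the quadratic form in `L V` given by the inverse of that matrix
has the chi-squared distribution: for `(L * S * Lᵀ)⁻¹ = Bᵀ * B` the vector `B L V` is standard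
Gaussian, and the quadratic form is the square of its norm. -/
theorem map_quadraticForm_multivariateGaussian {m : ℕ} {ι : Type*} [Fintype ι] [DecidableEq ι]
    {S : Matrix ι ι ℝ} (hS : S.PosSemidef) (L : Matrix (Fin m) ι ℝ) (hunit : IsUnit (L * S * Lᵀ)) :
    (multivariateGaussian 0 S).map
      (fun v => (L *ᵥ v.ofLp) ⬝ᵥ ((L * S * Lᵀ)⁻¹ *ᵥ (L *ᵥ v.ofLp))) = chiSquared m := by
  have hpos : (L * S * Lᵀ).PosSemidef := by
    simpa using hS.mul_mul_conjTranspose_same L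
  obtain ⟨B, hB⟩ : ∃ B : Matrix (Fin m) (Fin m) ℝ, (L * S * Lᵀ)⁻¹ = Bᵀ * B := by
    open scoped MatrixOrder in
    obtain ⟨B, hB⟩ := CStarAlgebra.nonneg_iff_eq_star_mul_self.mp hpos.inv.nonneg
    exact ⟨B, by simpa [Matrix.star_eq_conjTranspose] using hB⟩
  have hone : (B * L) * S * (B * L)ᵀ = 1 := by
    have h1 : Bᵀ * (B * (L * S * Lᵀ)) = 1 := by
      rw [← Matrix.mul_assoc, ← hB, Matrix.nonsing_inv_mul _ ((Matrix.isUnit_iff_isUnit_det _).1 hunit)]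
    have h2 := mul_eq_one_comm.1 h1
    simpa [Matrix.transpose_mul, Matrix.mul_assoc] using h2
  have hstd : (multivariateGaussian 0 S).map
      (fun v => (WithLp.toLp 2 ((B * L) *ᵥ v.ofLp) : EuclideanSpace ℝ (Fin m))) =
      stdGaussian (EuclideanSpace ℝ (Fin m)) := by
    have hmeas : Measurable fun v : EuclideanSpace ℝ ι =>
        (WithLp.toLp 2 ((B * L) *ᵥ v.ofLp) : EuclideanSpace ℝ (Fin m)) := by
      refine (WithLp.measurable_toLp 2 _).comp (measurable_pi_lambda _ fun i => ?_)
      simp only [Matrix.mulVec, dotProduct]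
      fun_prop
    have : IsProbabilityMeasure ((multivariateGaussian 0 S).map fun v : EuclideanSpace ℝ ι =>
        (WithLp.toLp 2 ((B * L) *ᵥ v.ofLp) : EuclideanSpace ℝ (Fin m))) :=
      Measure.isProbabilityMeasure_map hmeas.aemeasurable
    refine Measure.ext_of_charFun (funext fun t => ?_)
    have hadj (v : EuclideanSpace ℝ ι) :
        inner ℝ (WithLp.toLp 2 ((B * L) *ᵥ v.ofLp) : EuclideanSpace ℝ (Fin m)) t =
        inner ℝ v (WithLp.toLp 2 ((B * L)ᵀ *ᵥ t.ofLp)) := by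
      simp only [EuclideanSpace.inner_eq_star_dotProduct, star_trivial]
      rw [Matrix.dotProduct_mulVec, Matrix.mulVec_transpose]
    have hquad : ((B * L)ᵀ *ᵥ t.ofLp) ⬝ᵥ (S *ᵥ ((B * L)ᵀ *ᵥ t.ofLp)) = ‖t‖ ^ 2 := by
      rw [Matrix.mulVec_transpose, ← Matrix.dotProduct_mulVec, ← Matrix.mulVec_transpose,
        Matrix.mulVec_mulVec, Matrix.mulVec_mulVec, hone, Matrix.one_mulVec,
        EuclideanSpace.real_norm_sq_eq]
      simp [dotProduct, sq]
    rw [charFun_apply, integral_map hmeas.aemeasurable (by fun_prop)]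
    simp only [hadj]
    rw [← charFun_apply, charFun_multivariateGaussian hS, charFun_stdGaussian]
    simp only [hquad]
    simp [neg_div]
  rw [← map_sum_sq_stdGaussian, ← hstd, Measure.map_map (by fun_prop) ?_]
  · congr 1
    ext v
    simp only [Function.comp_apply, hB, ← Matrix.mulVec_mulVec]
    rw [Matrix.dotProduct_mulVec, Matrix.vecMul_transpose]
    simp [dotProduct, sq]
  · refine (WithLp.measurable_toLp 2 _).comp (measurable_pi_lambda _ fun i => ?_)
    simp only [Matrix.mulVec, dotProduct]
    fun_prop

/-! ### Matrices with entries `s (max i j)` -/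

section MaxMatrix

variable {ι : Type*} [LinearOrder ι] [Fintype ι]

/-- If `s` has no zeros and takes different values at neighbouring indices, the matrix with entries
`s (max i j)` is invertible: for a vector `x` supported on the indices `≥ i`, the entries `i` and
`i + 1` of the product with `x` differ by `(s i - s (i + 1)) * x i`. -/
theorem isUnit_of_max {s : ι → ℝ} (h0 : ∀ i, s i ≠ 0) (hs : ∀ i j, i ⋖ j → s i ≠ s j) :
    IsUnit (Matrix.of fun i j => s (max i j)) := by
  refine Matrix.mulVec_injective_iff_isUnit.1 ?_
  refine (injective_iff_map_eq_zero
    (Matrix.mulVecLin (Matrix.of fun i j : ι => s (max i j)))).2 fun x hx => ?_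
  by_contra hne
  obtain ⟨k, hk⟩ := Function.ne_iff.1 hne
  obtain ⟨i, hi, hmin⟩ := WellFounded.has_min (wellFounded_lt (α := ι)) {k | x k ≠ 0} ⟨k, hk⟩
  have hlt (j : ι) (hj : j < i) : x j = 0 := by
    by_contra h
    exact hmin j h hj
  have hrow (j : ι) : ∑ k, s (max j k) * x k = 0 := by
    have := congrFun hx j
    simpa [Matrix.mulVec, dotProduct] using this
  by_cases htop : IsMax i
  · have := hrow i
    rw [Finset.sum_eq_single i] at this
    · simp [h0, hi.out] at this
    · intro k _ hk
      rw [hlt k (lt_of_le_of_ne (htop.isTop k) hk), mul_zero]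
    · simp
  · obtain ⟨j, hij⟩ := exists_covBy_of_wellFoundedLT htop
    have hdiff : ∑ k, (s (max i k) - s (max j k)) * x k = 0 := by
      simp [sub_mul, Finset.sum_sub_distrib, hrow]
    rw [Finset.sum_eq_single i] at hdiff
    · rw [max_self, max_eq_left hij.le, mul_eq_zero, sub_eq_zero] at hdiff
      exact hdiff.elim (hs i j hij) hi
    · intro k _ hk
      rcases lt_or_gt_of_ne hk with h | h
      · rw [hlt k h, mul_zero]
      · rw [max_eq_right h.le, max_eq_right (hij.ge_of_gt h), sub_self, zero_mul]
    · simp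

theorem not_isUnit_of_max {s : ι → ℝ} {i j : ι} (hij : i ⋖ j) (hs : s i = s j) :
    ¬ IsUnit (Matrix.of fun i j => s (max i j)) := by
  rw [Matrix.isUnit_iff_isUnit_det, Matrix.det_zero_of_row_eq hij.ne]
  · simp
  · funext k
    simp only [Matrix.of_apply]
    rcases lt_or_ge i k with h | h
    · rw [max_eq_right h.le, max_eq_right (hij.ge_of_gt h)]
    · rw [max_eq_left h, max_eq_left (h.trans hij.le), hs]

end MaxMatrix

theorem measurable_matrix_inv_apply {ι : Type*} [Fintype ι] [DecidableEq ι] (i j : ι) :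
    Measurable fun A : ι → ι → ℝ => (Matrix.of A)⁻¹ i j := by
  have hc : Continuous fun A : ι → ι → ℝ => (Matrix.of A : Matrix ι ι ℝ) :=
    continuous_matrix fun i j => by simpa using (continuous_apply_apply i j)
  simp only [Matrix.inv_def, Ring.inverse_eq_inv', Matrix.smul_apply, smul_eq_mul]
  exact hc.matrix_det.measurable.inv.mul (hc.matrix_adjugate.matrix_elem i j).measurable

/-! ### Empirical frequencies -/

section EmpiricalFrequency

variable {Ω 𝓧 : Type*}

/-- The proportion of the first `n` observations that fall into the set `A`. -/
noncomputable def empFreq (U : ℕ → Ω → 𝓧) (A : Set 𝓧) (n : ℕ) (ω : Ω) : ℝ :=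
  (1 / (n : ℝ)) * ∑ k ∈ Finset.range n, A.indicator 1 (U k ω)

variable [MeasurableSpace Ω] [MeasurableSpace 𝓧] {P : Measure Ω} {ν : Measure 𝓧} {U : ℕ → Ω → 𝓧}

theorem aemeasurable_empFreq (hlaw : ∀ k, HasLaw (U k) ν P) {A : Set 𝓧} (hA : MeasurableSet A)
    (n : ℕ) : AEMeasurable (empFreq U A n) P := by
  refine (Finset.aemeasurable_fun_sum _ fun k _ => ?_).const_mul _
  exact ((measurable_const (a := (1 : ℝ))).indicator hA).comp_aemeasurable (hlaw k).aemeasurable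

theorem ae_empFreq_congr (hlaw : ∀ k, HasLaw (U k) ν P) {A B : Set 𝓧} (hA : MeasurableSet A)
    (hB : MeasurableSet B) (hAB : A =ᵐ[ν] B) :
    ∀ᵐ ω ∂P, ∀ n, empFreq U A n ω = empFreq U B n ω := by
  have h : ∀ᵐ x ∂ν, x ∈ A ↔ x ∈ B := by
    filter_upwards [hAB] with x hx using iff_of_eq hx
  have hmeas : Measurable fun x => (x ∈ A ↔ x ∈ B) := by
    exact (measurable_mem.2 hA).iff (measurable_mem.2 hB)
  have hU : ∀ᵐ ω ∂P, ∀ k, U k ω ∈ A ↔ U k ω ∈ B :=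
    ae_all_iff.2 fun k => ((hlaw k).ae_iff hmeas).2 h
  filter_upwards [hU] with ω hω n
  refine congrArg _ (Finset.sum_congr rfl fun k _ => ?_)
  by_cases hk : U k ω ∈ A
  · rw [Set.indicator_of_mem hk, Set.indicator_of_mem ((hω k).1 hk)]
  · rw [Set.indicator_of_notMem hk, Set.indicator_of_notMem (mt (hω k).2 hk)]

theorem integral_indicator_one_comp (hlaw : ∀ k, HasLaw (U k) ν P) {A : Set 𝓧}
    (hA : MeasurableSet A) (k : ℕ) :
    ∫ ω, A.indicator (1 : 𝓧 → ℝ) (U k ω) ∂P = ν.real A := by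
  have := (hlaw k).integral_comp (f := A.indicator (1 : 𝓧 → ℝ))
    ((measurable_const (a := (1 : ℝ))).indicator hA).aestronglyMeasurable
  rw [Function.comp_def] at this
  rw [this, integral_indicator_one hA]

theorem cov_indicator_comp [IsProbabilityMeasure ν] (hlaw : ∀ k, HasLaw (U k) ν P) {A B : Set 𝓧}
    (hA : MeasurableSet A) (hB : MeasurableSet B) (k : ℕ) :
    cov[fun ω => A.indicator (1 : 𝓧 → ℝ) (U k ω), fun ω => B.indicator (1 : 𝓧 → ℝ) (U k ω); P] =
      ν.real (A ∩ B) - ν.real A * ν.real B := by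
  have hmem {A : Set 𝓧} (hA : MeasurableSet A) : MemLp (A.indicator (1 : 𝓧 → ℝ)) 2 ν :=
    memLp_indicator_const 2 hA (1 : ℝ) (Or.inr (measure_ne_top _ _))
  rw [(hlaw k).covariance_fun_comp (hmem hA).aemeasurable (hmem hB).aemeasurable,
    covariance_eq_sub (hmem hA) (hmem hB), ← Set.inter_indicator_one,
    integral_indicator_one hA, integral_indicator_one hB,
    integral_indicator_one (hA.inter hB)]

variable [IsProbabilityMeasure P]

theorem ae_tendsto_empFreq (hlaw : ∀ k, HasLaw (U k) ν P) (hindep : iIndepFun U P) {A : Set 𝓧}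
    (hA : MeasurableSet A) :
    ∀ᵐ ω ∂P, Tendsto (fun n => empFreq U A n ω) atTop (𝓝 (ν.real A)) := by
  have hm : Measurable (A.indicator (1 : 𝓧 → ℝ)) := measurable_const.indicator hA
  have h := strong_law_ae_real (μ := P) (fun k ω => A.indicator (1 : 𝓧 → ℝ) (U k ω))
    (Integrable.of_bound (hm.comp_aemeasurable (hlaw 0).aemeasurable).aestronglyMeasurable 1
      (ae_of_all _ fun ω => by
        simp only [Set.indicator]
        split_ifs <;> simp))
    (fun i j hij => (hindep.indepFun hij).comp hm hm)
    (fun k => ((hlaw k).identDistrib (hlaw 0)).comp hm)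
  rw [integral_indicator_one_comp hlaw hA] at h
  filter_upwards [h] with ω hω
  simpa only [empFreq, div_eq_inv_mul, mul_one] using hω

/-- Joint asymptotic normality of finitely many empirical frequencies. -/
theorem tendstoInDistribution_empFreq {ι : Type*} [Fintype ι] [DecidableEq ι]
    [IsProbabilityMeasure ν] (hlaw : ∀ k, HasLaw (U k) ν P) (hindep : iIndepFun U P)
    {A : ι → Set 𝓧} (hA : ∀ i, MeasurableSet (A i)) :
    (Matrix.of fun i j => ν.real (A i ∩ A j) - ν.real (A i) * ν.real (A j)).PosSemidef ∧
    TendstoInDistribution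
      (fun (n : ℕ) ω => (WithLp.toLp 2 fun i => √n * (empFreq U (A i) n ω - ν.real (A i)) :
        EuclideanSpace ℝ ι)) atTop id (fun _ => P)
      (multivariateGaussian 0
        (Matrix.of fun i j => ν.real (A i ∩ A j) - ν.real (A i) * ν.real (A j))) := by
  have hm : Measurable fun (x : 𝓧) (i : ι) => (A i).indicator (1 : 𝓧 → ℝ) x :=
    measurable_pi_lambda _ fun i => measurable_const.indicator (hA i)
  have hX (i : ι) : MemLp (fun ω => (A i).indicator (1 : 𝓧 → ℝ) (U 0 ω)) 2 P := by
    refine MemLp.of_bound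
      (((measurable_pi_apply i).comp hm).comp_aemeasurable
        (hlaw 0).aemeasurable).aestronglyMeasurable 1 (ae_of_all _ fun ω => ?_)
    simp only [Set.indicator]
    split_ifs <;> simp
  have hcov : covMatrix P (fun ω i => (A i).indicator (1 : 𝓧 → ℝ) (U 0 ω)) =
      Matrix.of fun i j => ν.real (A i ∩ A j) - ν.real (A i) * ν.real (A j) := by
    ext i j
    exact cov_indicator_comp hlaw (hA i) (hA j) 0
  have hclt := tendstoInDistribution_inv_sqrt_mul_sum_sub_multivariate
    (X := fun k ω i => (A i).indicator (1 : 𝓧 → ℝ) (U k ω)) hX (hindep.comp (fun _ => _) fun _ => hm)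
    (fun k => ((hlaw k).identDistrib (hlaw 0)).comp hm)
  rw [← hcov]
  refine ⟨posSemidef_covMatrix hX, ?_⟩
  convert! hclt using 4 with n ω
  funext i
  rw [integral_indicator_one_comp hlaw (hA i), empFreq]
  -- For `n = 0` both sides vanish, as `√0 = 0`.
  rcases Nat.eq_zero_or_pos n with rfl | hn
  · simp
  · have h1 : (√n : ℝ) ≠ 0 := by positivity
    have h2 : (√n : ℝ) ^ 2 = n := Real.sq_sqrt n.cast_nonneg
    generalize √n = r at *
    rw [← h2]
    field_simp

end EmpiricalFrequency

/-! ### Tail regions of a copula -/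

/-- The lower tail region `(-∞, u]²` of the plane. -/
def lowerTail (u : ℝ) : Set (ℝ × ℝ) := {x | x.1 ≤ u ∧ x.2 ≤ u}

/-- The upper tail region `[1 - u, ∞)²` of the plane. -/
def upperTail (u : ℝ) : Set (ℝ × ℝ) := {x | 1 - u ≤ x.1 ∧ 1 - u ≤ x.2}

theorem measurableSet_lowerTail (u : ℝ) : MeasurableSet (lowerTail u) :=
  (measurableSet_le measurable_fst measurable_const).inter
    (measurableSet_le measurable_snd measurable_const)

theorem measurableSet_upperTail (u : ℝ) : MeasurableSet (upperTail u) :=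
  (measurableSet_le measurable_const measurable_fst).inter
    (measurableSet_le measurable_const measurable_snd)

theorem lowerTail_mono {u v : ℝ} (h : u ≤ v) : lowerTail u ⊆ lowerTail v :=
  fun _ hx => ⟨hx.1.trans h, hx.2.trans h⟩

theorem upperTail_mono {u v : ℝ} (h : u ≤ v) : upperTail u ⊆ upperTail v :=
  fun _ hx => ⟨(sub_le_sub_left h 1).trans hx.1, (sub_le_sub_left h 1).trans hx.2⟩

theorem TL_eq_empFreq {Ω : Type*} (U : ℕ → Ω → ℝ × ℝ) (n : ℕ) (u : ℝ) :
    TL U n u = empFreq U (lowerTail u) n := by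
  funext ω
  refine congrArg _ (Finset.sum_congr rfl fun k _ => ?_)
  by_cases h : U k ω ∈ lowerTail u
  · rw [Set.indicator_of_mem h, Pi.one_apply]
    exact if_pos h
  · rw [Set.indicator_of_notMem h]
    exact if_neg h

theorem TU_eq_empFreq {Ω : Type*} (U : ℕ → Ω → ℝ × ℝ) (n : ℕ) (u : ℝ) :
    TU U n u = empFreq U (upperTail u) n := by
  funext ω
  refine congrArg _ (Finset.sum_congr rfl fun k _ => ?_)
  by_cases h : U k ω ∈ upperTail u
  · rw [Set.indicator_of_mem h, Pi.one_apply]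
    exact if_pos h
  · rw [Set.indicator_of_notMem h]
    exact if_neg h

theorem cdf_uniform {t : ℝ} (ht : t ∈ Set.Icc (0 : ℝ) 1) :
    cdf (volume.restrict (Set.Icc (0 : ℝ) 1)) t = t := by
  have : IsProbabilityMeasure (volume.restrict (Set.Icc (0 : ℝ) 1)) := ⟨by simp⟩
  rw [cdf_eq_real, measureReal_restrict_apply measurableSet_Iic]
  have : Set.Iic t ∩ Set.Icc (0 : ℝ) 1 = Set.Icc 0 t := by
    ext x
    simp only [Set.mem_inter_iff, Set.mem_Iic, Set.mem_Icc]
    exact ⟨fun h => ⟨h.2.1, h.1⟩, fun h => ⟨h.2, h.1, h.2.trans ht.2⟩⟩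
  rw [this, Real.volume_real_Icc_of_le ht.1, sub_zero]

theorem IsCopulaLaw.ae_fst {ν : Measure (ℝ × ℝ)} (hν : IsCopulaLaw ν) {p : ℝ → Prop}
    (hp : ∀ᵐ t ∂(volume.restrict (Set.Icc (0 : ℝ) 1)), p t) : ∀ᵐ x ∂ν, p x.1 := by
  rw [← hν.map_fst] at hp
  exact ae_of_ae_map measurable_fst.aemeasurable hp

theorem IsCopulaLaw.ae_snd {ν : Measure (ℝ × ℝ)} (hν : IsCopulaLaw ν) {p : ℝ → Prop}
    (hp : ∀ᵐ t ∂(volume.restrict (Set.Icc (0 : ℝ) 1)), p t) : ∀ᵐ x ∂ν, p x.2 := by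
  rw [← hν.map_snd] at hp
  exact ae_of_ae_map measurable_snd.aemeasurable hp

/-- The margins being the identity on `[0, 1]` and without atoms, `α(u)` is the logarithm of the
ratio of the probabilities of the (closed) tail regions. -/
theorem alpha_eq {ν : Measure (ℝ × ℝ)} (hν : IsCopulaLaw ν) (u : ℝ) :
    alpha ν u = logRatio (ν.real (upperTail u)) (ν.real (lowerTail u)) := by
  have hmem : ∀ᵐ t ∂(volume.restrict (Set.Icc (0 : ℝ) 1)),
      t ≠ 1 - u ∧ cdf (volume.restrict (Set.Icc (0 : ℝ) 1)) t = t := by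
    have h1 : ∀ᵐ t ∂(volume.restrict (Set.Icc (0 : ℝ) 1)), t ≠ 1 - u :=
      Measure.ae_ne _ _
    filter_upwards [h1, ae_restrict_mem measurableSet_Icc] with t ht ht'
    exact ⟨ht, cdf_uniform ht'⟩
  have h1 := hν.ae_fst hmem
  have h2 := hν.ae_snd hmem
  rw [alpha, hν.map_fst, hν.map_snd]
  congr 1
  · refine measureReal_congr ?_
    filter_upwards [h1, h2] with x hx hy
    refine propext ?_
    change (_ < _ ∧ _ < _) ↔ (_ ≤ _ ∧ _ ≤ _)
    rw [hx.2, hy.2, lt_iff_le_and_ne, lt_iff_le_and_ne]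
    simp [hx.1.symm, hy.1.symm]
  · refine measureReal_congr ?_
    filter_upwards [h1, h2] with x hx hy
    refine propext ?_
    change (_ ≤ _ ∧ _ ≤ _) ↔ (_ ≤ _ ∧ _ ≤ _)
    rw [hx.2, hy.2]

/-- For levels at most `1/2` the lower and the upper tail region meet at most in the point
`(1/2, 1/2)`, which is a null set. -/
theorem measureReal_upperTail_inter_lowerTail {ν : Measure (ℝ × ℝ)} (hν : IsCopulaLaw ν) {u v : ℝ}
    (hu : u ≤ 1 / 2) (hv : v ≤ 1 / 2) : ν.real (upperTail u ∩ lowerTail v) = 0 := by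
  have h : ∀ᵐ x ∂ν, x.1 ≠ 1 / 2 := hν.ae_fst (p := fun t => t ≠ 1 / 2) (Measure.ae_ne _ _)
  refine (measureReal_eq_zero_iff (by have := hν.isProbabilityMeasure; simp)).2 ?_
  refine measure_mono_null (fun x hx => ?_) h
  have h1 := hx.1.1
  have h2 := hx.2.1
  simp only [Set.mem_compl_iff, Set.mem_ofPred_eq, not_not]
  linarith

/-! ### The limiting covariance matrix -/

/-- The value `1 / p + 1 / q` of the asymptotic variance for tail probabilities `p` and `q`, with
both fractions brought to the common denominator. -/
noncomputable def tailVar (p q : ℝ) : ℝ := (p + q) / (p * q)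

theorem tailVar_eq {p q : ℝ} (hp : p ≠ 0) (hq : q ≠ 0) : tailVar p q = p⁻¹ + q⁻¹ := by
  rw [tailVar]
  field_simp
  ring

/-- The linearization of `log q - log p` in the tail probabilities `q` (upper tails, the left
half of the indices) and `p` (lower tails, the right half). -/
noncomputable def logRatioDeriv {m : ℕ} (p q : Fin m → ℝ) : Matrix (Fin m) (Fin m ⊕ Fin m) ℝ :=
  Matrix.of fun i => Sum.elim (fun j => if i = j then (q i)⁻¹ else 0)
    fun j => if i = j then -(p i)⁻¹ else 0

theorem logRatioDeriv_mulVec {m : ℕ} (p q : Fin m → ℝ) (v : Fin m ⊕ Fin m → ℝ) (i : Fin m) :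
    (logRatioDeriv p q *ᵥ v) i = (q i)⁻¹ * v (.inl i) - (p i)⁻¹ * v (.inr i) := by
  simp [Matrix.mulVec, dotProduct, logRatioDeriv, sub_eq_add_neg]

/-- The joint tail regions of a family of levels: upper tails on the left half of the indices, lower
tails on the right half. -/
def tails {m : ℕ} (u : Fin m → ℝ) : Fin m ⊕ Fin m → Set (ℝ × ℝ) :=
  Sum.elim (fun i => upperTail (u i)) fun i => lowerTail (u i)

/-- The delta method turns the covariance matrix of the tail indicators into the matrix with entries
`1 / p + 1 / q` at the larger index: `P(A ∩ B) / (P(A) P(B))` is `1 / P(B)` for nested `A ⊆ B`, it is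
`0` for one upper and one lower tail, and the products of the means cancel. -/
theorem logRatioDeriv_mul_cov_mul_transpose {ν : Measure (ℝ × ℝ)} (hν : IsCopulaLaw ν) {m : ℕ}
    {u : Fin m → ℝ} (hu : ∀ i, u i ≤ 1 / 2) (hmono : Monotone u) {p q : Fin m → ℝ}
    (hp : ∀ i, p i = ν.real (lowerTail (u i))) (hq : ∀ i, q i = ν.real (upperTail (u i)))
    (hp0 : ∀ i, p i ≠ 0) (hq0 : ∀ i, q i ≠ 0) :
    logRatioDeriv p q * (Matrix.of fun a b =>
        ν.real (tails u a ∩ tails u b) - ν.real (tails u a) * ν.real (tails u b)) *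
      (logRatioDeriv p q)ᵀ = Matrix.of fun i j => tailVar (p (max i j)) (q (max i j)) := by
  have hl (i j) : ν.real (lowerTail (u i) ∩ lowerTail (u j)) = p (min i j) := by
    rcases le_total i j with h | h
    · rw [Set.inter_eq_left.2 (lowerTail_mono (hmono h)), min_eq_left h, hp]
    · rw [Set.inter_eq_right.2 (lowerTail_mono (hmono h)), min_eq_right h, hp]
  have hr (i j) : ν.real (upperTail (u i) ∩ upperTail (u j)) = q (min i j) := by
    rcases le_total i j with h | h
    · rw [Set.inter_eq_left.2 (upperTail_mono (hmono h)), min_eq_left h, hq]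
    · rw [Set.inter_eq_right.2 (upperTail_mono (hmono h)), min_eq_right h, hq]
  have hc (i j) : ν.real (upperTail (u i) ∩ lowerTail (u j)) = 0 :=
    measureReal_upperTail_inter_lowerTail hν (hu i) (hu j)
  have hc' (i j) : ν.real (lowerTail (u i) ∩ upperTail (u j)) = 0 := by
    rw [Set.inter_comm, hc]
  ext i j
  rw [Matrix.mul_apply]
  simp only [Matrix.mul_apply, Matrix.transpose_apply, Fintype.sum_sum_type, logRatioDeriv, tails,
    Matrix.of_apply, Sum.elim_inl, Sum.elim_inr, hl, hr, hc, hc', ← hp, ← hq, ite_mul, mul_ite,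
    zero_mul, mul_zero, Finset.sum_ite_eq, Finset.mem_univ, if_true]
  rw [tailVar_eq (hp0 _) (hq0 _)]
  have := hp0 i
  have := hp0 j
  have := hq0 i
  have := hq0 j
  rcases le_total i j with h | h
  · rw [min_eq_left h, max_eq_right h]
    field_simp
    ring
  · rw [min_eq_right h, max_eq_left h]
    field_simp
    ring

/-! ### Consequences of the invertibility of the plug-in matrix -/

section Invertible

variable {Ω : Type*} [MeasurableSpace Ω] {P : Measure Ω}
  {ν : Measure (ℝ × ℝ)} {U : ℕ → Ω → ℝ × ℝ} {m : ℕ} {u : Fin m → ℝ}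

/-- The events on which the plug-in matrix is invertible cannot all be null sets. -/
theorem not_ae_notMem_invertibleEvent
    (hinv : Tendsto (fun n => P (invertibleEvent U u n)) atTop (𝓝 1)) :
    ¬ ∀ᵐ ω ∂P, ∀ n, ω ∉ invertibleEvent U u n := by
  intro h
  have h0 (n : ℕ) : P (invertibleEvent U u n) = 0 :=
    measure_eq_zero_iff_ae_notMem.2 (h.mono fun ω hω => hω n)
  simp only [h0] at hinv
  exact zero_ne_one (tendsto_nhds_unique tendsto_const_nhds hinv)

/-- If a tail has probability zero, then its empirical frequency almost surely vanishes for all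
sample sizes. -/
theorem tail_prob_ne_zero [IsFiniteMeasure ν] (hlaw : ∀ k, HasLaw (U k) ν P)
    (hinv : Tendsto (fun n => P (invertibleEvent U u n)) atTop (𝓝 1)) (i : Fin m) :
    ν.real (lowerTail (u i)) ≠ 0 ∧ ν.real (upperTail (u i)) ≠ 0 := by
  have hzero {A : Set (ℝ × ℝ)} (hA : MeasurableSet A) (h : ν.real A = 0) :
      ∀ᵐ ω ∂P, ∀ n, empFreq U A n ω = 0 := by
    have hA0 : A =ᵐ[ν] (∅ : Set (ℝ × ℝ)) := ae_eq_empty.2 ((measureReal_eq_zero_iff).1 h)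
    filter_upwards [ae_empFreq_congr hlaw hA MeasurableSet.empty hA0] with ω hω n
    rw [hω n]
    simp [empFreq]
  refine ⟨fun h => not_ae_notMem_invertibleEvent hinv ?_,
    fun h => not_ae_notMem_invertibleEvent hinv ?_⟩
  · filter_upwards [hzero (measurableSet_lowerTail _) h] with ω hω n hmem
    exact hmem.1 i (by rw [TL_eq_empFreq, hω n, zero_mul])
  · filter_upwards [hzero (measurableSet_upperTail _) h] with ω hω n hmem
    exact hmem.1 i (by rw [TU_eq_empFreq, hω n, mul_zero])

/-- The limiting covariance matrix is invertible. Otherwise the tail probabilities at two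
neighbouring levels coincide, so that almost surely no observation separates the two levels, and the
plug-in matrix has two equal rows for all sample sizes. -/
theorem isUnit_limit [IsFiniteMeasure ν] (hlaw : ∀ k, HasLaw (U k) ν P) (hmono : Monotone u)
    (hinv : Tendsto (fun n => P (invertibleEvent U u n)) atTop (𝓝 1)) :
    IsUnit (Matrix.of fun i j => tailVar (ν.real (lowerTail (u (max i j))))
      (ν.real (upperTail (u (max i j))))) := by
  have hp (i : Fin m) : 0 < ν.real (lowerTail (u i)) :=
    measureReal_nonneg.lt_of_ne' (tail_prob_ne_zero hlaw hinv i).1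
  have hq (i : Fin m) : 0 < ν.real (upperTail (u i)) :=
    measureReal_nonneg.lt_of_ne' (tail_prob_ne_zero hlaw hinv i).2
  refine isUnit_of_max
    (s := fun i => tailVar (ν.real (lowerTail (u i))) (ν.real (upperTail (u i))))
    (fun i => ?_) fun i j hij hs => not_ae_notMem_invertibleEvent hinv ?_
  · have := hp i
    have := hq i
    exact (div_pos (by positivity) (by positivity)).ne'
  have hle := hmono hij.le
  simp only [tailVar_eq (hp _).ne' (hq _).ne'] at hs
  have h1 := inv_anti₀ (hp i) (measureReal_mono (μ := ν) (lowerTail_mono hle))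
  have h2 := inv_anti₀ (hq i) (measureReal_mono (μ := ν) (upperTail_mono hle))
  have hpe : ν.real (lowerTail (u i)) = ν.real (lowerTail (u j)) := inv_injective (by linarith)
  have hqe : ν.real (upperTail (u i)) = ν.real (upperTail (u j)) := inv_injective (by linarith)
  have hae {A B : Set (ℝ × ℝ)} (hA : MeasurableSet A) (hAB : A ⊆ B) (h : ν.real A = ν.real B) :
      A =ᵐ[ν] B :=
    ae_eq_of_subset_of_measure_ge hAB
      ((measureReal_eq_measureReal_iff).1 h).ge hA.nullMeasurableSet (measure_ne_top _ _)
  filter_upwards [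
    ae_empFreq_congr hlaw (measurableSet_lowerTail _) (measurableSet_lowerTail _)
      (hae (measurableSet_lowerTail _) (lowerTail_mono hle) hpe),
    ae_empFreq_congr hlaw (measurableSet_upperTail _) (measurableSet_upperTail _)
      (hae (measurableSet_upperTail _) (upperTail_mono hle) hqe)] with ω hL hU n hmem
  refine not_isUnit_of_max (s := fun i => tailVar (TL U n (u i) ω) (TU U n (u i) ω)) hij ?_ hmem.2
  simp only [TL_eq_empFreq, TU_eq_empFreq, hL n, hU n]

end Invertible

/-! ### Reduction of the test statistic to a continuous function of a convergent pair -/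

theorem toReal_logRatio {x y : ℝ} (hx : 0 < x) (hy : 0 < y) :
    (logRatio x y).toReal = Real.log x - Real.log y := by
  rw [logRatio, if_neg hy.ne', if_neg hx.ne', EReal.toReal_coe, Real.log_div hx.ne' hy.ne']

theorem measurable_dslope_log (a : ℝ) : Measurable (dslope Real.log a) := by
  have h : dslope Real.log a =
      fun x => if x = a then deriv Real.log a else (x - a)⁻¹ * (Real.log x - Real.log a) := by
    funext x
    split_ifs with hx
    · rw [hx, dslope_same]
    · rw [dslope_of_ne _ hx, slope_def_field, div_eq_inv_mul]
  rw [h]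
  refine Measurable.ite (measurableSet_singleton a) measurable_const ?_
  exact (measurable_id.sub_const a).inv.mul (Real.measurable_log.sub_const _)

theorem tendsto_dslope_log {a : ℝ} (ha : 0 < a) : Tendsto (dslope Real.log a) (𝓝 a) (𝓝 a⁻¹) := by
  have h := (continuousAt_dslope_same.2 (Real.differentiableAt_log ha.ne')).tendsto
  rwa [dslope_same, Real.deriv_log] at h

theorem measurable_toReal_logRatio :
    Measurable fun x : ℝ × ℝ => (logRatio x.1 x.2).toReal := by
  have h : (fun x : ℝ × ℝ => (logRatio x.1 x.2).toReal) =
      fun x => if x.2 = 0 then 0 else if x.1 = 0 then 0 else Real.log (x.1 / x.2) := by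
    funext x
    simp only [logRatio]
    split_ifs <;> simp
  rw [h]
  exact Measurable.ite (measurableSet_eq_fun measurable_snd measurable_const) measurable_const
    (Measurable.ite (measurableSet_eq_fun measurable_fst measurable_const) measurable_const
      (Real.measurable_log.comp (measurable_fst.div measurable_snd)))

/-- The quadratic form `aᵀ K a` at `a i = c i * v (inl i) - d i * v (inr i)`, as a function of the
vector `v` and of the coefficients `(c, d, K)`. -/
noncomputable def pairedForm {m : ℕ} (x : EuclideanSpace ℝ (Fin m ⊕ Fin m) ×
    ((Fin m → ℝ) × (Fin m → ℝ) × (Fin m → Fin m → ℝ))) : ℝ :=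
  ∑ i, (x.2.1 i * x.1 (.inl i) - x.2.2.1 i * x.1 (.inr i)) *
    ∑ j, x.2.2.2 i j * (x.2.1 j * x.1 (.inl j) - x.2.2.1 j * x.1 (.inr j))

theorem continuous_pairedForm (m : ℕ) : Continuous (pairedForm (m := m)) := by
  unfold pairedForm
  fun_prop

section Statistic

variable {Ω : Type*} {ν : Measure (ℝ × ℝ)} {U : ℕ → Ω → ℝ × ℝ} {m : ℕ} {u : Fin m → ℝ}

/-- The coefficients of the test statistic as a quadratic form in the centred and rescaled empirical
tail frequencies: the difference quotients of the logarithm between the true and the empirical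
frequencies, and the inverse of the plug-in matrix. -/
noncomputable def coeffs (ν : Measure (ℝ × ℝ)) (U : ℕ → Ω → ℝ × ℝ) (u : Fin m → ℝ) (n : ℕ) (ω : Ω) :
    (Fin m → ℝ) × (Fin m → ℝ) × (Fin m → Fin m → ℝ) :=
  (fun i => dslope Real.log (ν.real (upperTail (u i))) (TU U n (u i) ω),
    fun i => dslope Real.log (ν.real (lowerTail (u i))) (TL U n (u i) ω),
    fun i j => (SigmaHat U u n ω)⁻¹ i j)

/-- The deterministic step of consistency: along a realization with convergent empirical tail
frequencies the coefficients converge. -/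
theorem tendsto_coeffs {ω : Ω} {p q : Fin m → ℝ}
    (hpν : ∀ i, p i = ν.real (lowerTail (u i))) (hqν : ∀ i, q i = ν.real (upperTail (u i)))
    (hp : ∀ i, 0 < p i) (hq : ∀ i, 0 < q i)
    (hL : ∀ i, Tendsto (fun n => TL U n (u i) ω) atTop (𝓝 (p i)))
    (hU : ∀ i, Tendsto (fun n => TU U n (u i) ω) atTop (𝓝 (q i)))
    (hunit : IsUnit (Matrix.of fun i j => tailVar (p (max i j)) (q (max i j)))) :
    Tendsto (fun n => coeffs ν U u n ω) atTop (𝓝 (fun i => (q i)⁻¹, fun i => (p i)⁻¹,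
      fun i j => (Matrix.of fun i j => tailVar (p (max i j)) (q (max i j)))⁻¹ i j)) := by
  have hS : Tendsto (fun n => SigmaHat U u n ω) atTop
      (𝓝 (Matrix.of fun i j => tailVar (p (max i j)) (q (max i j)))) := by
    refine tendsto_pi_nhds.2 fun i => tendsto_pi_nhds.2 fun j => ?_
    exact ((hL _).add (hU _)).div ((hL _).mul (hU _)) (mul_pos (hp _) (hq _)).ne'
  have hdet := ((Matrix.isUnit_iff_isUnit_det _).1 hunit).ne_zero
  have hinv := (continuousAt_matrix_inv
    (Matrix.of fun i j => tailVar (p (max i j)) (q (max i j)))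
      (by rw [Ring.inverse_eq_inv']; exact continuousAt_inv₀ hdet)).tendsto.comp hS
  refine Tendsto.prodMk_nhds (tendsto_pi_nhds.2 fun i => ?_)
    (Tendsto.prodMk_nhds (tendsto_pi_nhds.2 fun i => ?_)
      (tendsto_pi_nhds.2 fun i => tendsto_pi_nhds.2 fun j => ?_))
  · rw [← hqν]
    exact (tendsto_dslope_log (hq i)).comp (hU i)
  · rw [← hpν]
    exact (tendsto_dslope_log (hp i)).comp (hL i)
  · exact tendsto_pi_nhds.1 (tendsto_pi_nhds.1 hinv i) j

/-- The delta method in exact form: where all empirical tail frequencies are positive, the test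
statistic is a quadratic form in the centred and rescaled frequencies. -/
theorem testStatistic_eq_pairedForm (hν : IsCopulaLaw ν) {n : ℕ} {ω : Ω}
    (hp : ∀ i, 0 < ν.real (lowerTail (u i))) (hq : ∀ i, 0 < ν.real (upperTail (u i)))
    (hL : ∀ i, 0 < TL U n (u i) ω) (hU : ∀ i, 0 < TU U n (u i) ω) :
    testStatistic ν U u n ω = pairedForm (WithLp.toLp 2 fun a =>
      √n * (empFreq U (tails u a) n ω - ν.real (tails u a)), coeffs ν U u n ω) := by
  have ha (i : Fin m) : aVec ν U u n ω i =
      (coeffs ν U u n ω).1 i *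
          (√n * (empFreq U (tails u (.inl i)) n ω - ν.real (tails u (.inl i)))) -
        (coeffs ν U u n ω).2.1 i *
          (√n * (empFreq U (tails u (.inr i)) n ω - ν.real (tails u (.inr i)))) := by
    have h1 := sub_smul_dslope Real.log (ν.real (upperTail (u i))) (TU U n (u i) ω)
    have h2 := sub_smul_dslope Real.log (ν.real (lowerTail (u i))) (TL U n (u i) ω)
    simp only [aVec, alphaHat, alpha_eq hν, toReal_logRatio (hU i) (hL i),
      toReal_logRatio (hq i) (hp i), tails, Sum.elim_inl, Sum.elim_inr, coeffs,
      ← TL_eq_empFreq, ← TU_eq_empFreq]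
    rw [smul_eq_mul] at h1 h2
    linear_combination -√n * h1 + √n * h2
  simp only [testStatistic, dotProduct, Matrix.mulVec, ha]
  rfl

variable [MeasurableSpace Ω] {P : Measure Ω}

theorem aemeasurable_TL (hlaw : ∀ k, HasLaw (U k) ν P) (n : ℕ) (t : ℝ) :
    AEMeasurable (TL U n t) P := by
  rw [TL_eq_empFreq]
  exact aemeasurable_empFreq hlaw (measurableSet_lowerTail t) n

theorem aemeasurable_TU (hlaw : ∀ k, HasLaw (U k) ν P) (n : ℕ) (t : ℝ) :
    AEMeasurable (TU U n t) P := by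
  rw [TU_eq_empFreq]
  exact aemeasurable_empFreq hlaw (measurableSet_upperTail t) n

theorem aemeasurable_SigmaHat_inv (hlaw : ∀ k, HasLaw (U k) ν P) (n : ℕ) (i j : Fin m) :
    AEMeasurable (fun ω => (SigmaHat U u n ω)⁻¹ i j) P := by
  have h : AEMeasurable (fun ω i j => SigmaHat U u n ω i j) P :=
    aemeasurable_pi_lambda _ fun i => aemeasurable_pi_lambda _ fun j =>
      ((aemeasurable_TL hlaw n _).add (aemeasurable_TU hlaw n _)).div
        ((aemeasurable_TL hlaw n _).mul (aemeasurable_TU hlaw n _))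
  exact (measurable_matrix_inv_apply i j).comp_aemeasurable h

theorem aemeasurable_testStatistic (hlaw : ∀ k, HasLaw (U k) ν P) (n : ℕ) :
    AEMeasurable (testStatistic ν U u n) P := by
  have ha (i : Fin m) : AEMeasurable (fun ω => aVec ν U u n ω i) P := by
    refine AEMeasurable.const_mul (AEMeasurable.sub_const ?_ _) _
    exact measurable_toReal_logRatio.comp_aemeasurable
      ((aemeasurable_TU hlaw n (u i)).prodMk (aemeasurable_TL hlaw n (u i)))
  unfold testStatistic
  simp only [dotProduct, Matrix.mulVec]
  exact Finset.aemeasurable_fun_sum _ fun i _ => (ha i).mul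
    (Finset.aemeasurable_fun_sum _ fun j _ => (aemeasurable_SigmaHat_inv hlaw n i j).mul (ha j))

theorem aemeasurable_coeffs (hlaw : ∀ k, HasLaw (U k) ν P) (n : ℕ) :
    AEMeasurable (coeffs ν U u n) P := by
  refine AEMeasurable.prodMk (aemeasurable_pi_lambda _ fun i => ?_)
    (AEMeasurable.prodMk (aemeasurable_pi_lambda _ fun i => ?_)
      (aemeasurable_pi_lambda _ fun i => aemeasurable_pi_lambda _ fun j =>
        aemeasurable_SigmaHat_inv hlaw n i j))
  · exact (measurable_dslope_log _).comp_aemeasurable (aemeasurable_TU hlaw n _)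
  · exact (measurable_dslope_log _).comp_aemeasurable (aemeasurable_TL hlaw n _)

end Statistic

end TailAsymmetry

open TailAsymmetry in
theorem mainTheorem2
    {Ω : Type*} [MeasurableSpace Ω] (P : Measure Ω) [IsProbabilityMeasure P]
    -- an iid sample from a copula
    (ν : Measure (ℝ × ℝ)) (hν : TailAsymmetry.IsCopulaLaw ν)
    (U : ℕ → Ω → ℝ × ℝ) (hlaw : ∀ i, HasLaw (U i) ν P) (hindep : iIndepFun U P)
    -- the levels `0 < u_1 < ⋯ < u_m ≤ 1/2`
    (m : ℕ) (u : Fin m → ℝ) (hu : ∀ i, 0 < u i ∧ u i ≤ 1 / 2) (hmono : StrictMono u)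
    -- the plug-in covariance matrix is invertible, with probability tending to one
    (hinv : Tendsto (fun n => P (TailAsymmetry.invertibleEvent U u n)) atTop (𝓝 1)) :
    TendstoInDistribution (fun n ω => TailAsymmetry.testStatistic ν U u n ω) atTop
      (id : ℝ → ℝ) (fun _ => P) (TailAsymmetry.chiSquared m) := by
  have : IsProbabilityMeasure ν := hν.isProbabilityMeasure
  obtain ⟨p, hp⟩ : ∃ p : Fin m → ℝ, ∀ i, p i = ν.real (lowerTail (u i)) := ⟨_, fun _ => rfl⟩
  obtain ⟨q, hq⟩ : ∃ q : Fin m → ℝ, ∀ i, q i = ν.real (upperTail (u i)) := ⟨_, fun _ => rfl⟩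
  have hp0 (i : Fin m) : 0 < p i := by
    rw [hp]
    exact measureReal_nonneg.lt_of_ne' (tail_prob_ne_zero hlaw hinv i).1
  have hq0 (i : Fin m) : 0 < q i := by
    rw [hq]
    exact measureReal_nonneg.lt_of_ne' (tail_prob_ne_zero hlaw hinv i).2
  have hunit : IsUnit (Matrix.of fun i j => tailVar (p (max i j)) (q (max i j))) := by
    simpa only [hp, hq] using isUnit_limit hlaw hmono.monotone hinv
  have hcov := logRatioDeriv_mul_cov_mul_transpose hν (fun i => (hu i).2) hmono.monotone hp hq
    (fun i => (hp0 i).ne') fun i => (hq0 i).ne'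
  have htails (a : Fin m ⊕ Fin m) : MeasurableSet (tails u a) := by
    rcases a with i | i
    · exact measurableSet_upperTail _
    · exact measurableSet_lowerTail _
  obtain ⟨hS, hclt⟩ := tendstoInDistribution_empFreq hlaw hindep htails
  -- The strong law of large numbers for all tail frequencies at once.
  have hslln : ∀ᵐ ω ∂P, (∀ i, Tendsto (fun n => TL U n (u i) ω) atTop (𝓝 (p i))) ∧
      ∀ i, Tendsto (fun n => TU U n (u i) ω) atTop (𝓝 (q i)) := by
    refine (ae_all_iff.2 fun i => ?_).and (ae_all_iff.2 fun i => ?_)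
    · simp only [TL_eq_empFreq, hp]
      exact ae_tendsto_empFreq hlaw hindep (measurableSet_lowerTail _)
    · simp only [TU_eq_empFreq, hq]
      exact ae_tendsto_empFreq hlaw hindep (measurableSet_upperTail _)
  have hcoeffs := tendstoInMeasure_of_tendsto_ae
    (fun n => (aemeasurable_coeffs (u := u) hlaw n).aestronglyMeasurable)
    (hslln.mono fun ω hω => tendsto_coeffs hp hq hp0 hq0 hω.1 hω.2 hunit)
  have hform := hclt.continuous_comp_prodMk_of_tendstoInMeasure_const (continuous_pairedForm m)
    hcoeffs (aemeasurable_coeffs hlaw)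
  have hT := tendstoInDistribution_of_tendstoInMeasure_sub (testStatistic ν U u) _ hform
    (tendstoInMeasure_of_tendsto_ae
      (fun n => ((aemeasurable_testStatistic hlaw n).sub
        (hform.forall_aemeasurable n)).aestronglyMeasurable) ?_)
    (aemeasurable_testStatistic hlaw)
  · refine ⟨hT.forall_aemeasurable, aemeasurable_id, ?_⟩
    convert! hT.tendsto using 2
    refine congrArg 𝓝 (Subtype.ext ?_)
    change Measure.map id _ = Measure.map _ _
    rw [Measure.map_id, ← map_quadraticForm_multivariateGaussian hS (logRatioDeriv p q)
      (hcov ▸ hunit), hcov]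
    congr 1
    funext v
    rw [funext (logRatioDeriv_mulVec p q v.ofLp)]
    rfl
  · -- Almost surely all tail frequencies are positive for large `n`, and then the statistic
    -- coincides with the quadratic form.
    filter_upwards [hslln] with ω hω
    refine tendsto_const_nhds.congr' ?_
    filter_upwards [eventually_all.2 fun i => (hω.1 i).eventually_const_lt (hp0 i),
      eventually_all.2 fun i => (hω.2 i).eventually_const_lt (hq0 i)] with n hL hU
    simp only [Pi.sub_apply, Pi.zero_apply]
    rw [testStatistic_eq_pairedForm hν (fun i => hp i ▸ hp0 i) (fun i => hq i ▸ hq0 i) hL hU,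
      sub_self]
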